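/- Let $\Omega\subset\mathbb R^2$ be a bounded connected open set. Let $1<p<+\infty$ and put $p^*:=\frac{2p}{2-p}$ if $p<2$ and $p^*:=+\infty$ if $p\ge 2$. For an open set $A\subset\Omega$ let $W_0^{1,p}(A)$ be the closure of $C_c^\infty(A)$ in the Sobolev space $W^{1,p}(A)$ of real-valued functions, and, for $1<q<p^*$, define the Poincaré–Sobolev constant $$C_{p,q}(A):=\sup_{u\in W_0^{1,p}(A),\ u\neq 0}\frac{\left(\int_A |u(x)|^q\,dx\right)^{p/q}}{\int_A|\nabla u(x)|^p\,dx}\in[0,+\infty],$$ with $C_{p,q}(\emptyset):=0$. Lemma (Maxitivity of Poincaré–Sobolev constants). Let $1<p\le q<p^*$. If $A_1,A_2\subset\Omega$ are open sets with $A_1\cap A_2=\emptyset$, then $$C_{p,q}(A_1\cup A_2)=\max\{C_{p,q}(A_1),\,C_{p,q}(A_2)\}.$$ -/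

import Mathlib

open MeasureTheory TopologicalSpace Filter
open scoped Topology ENNReal Distributions

noncomputable section

/-- The Euclidean plane `ℝ²`. -/
abbrev Plane : Type := EuclideanSpace ℝ (Fin 2)

/-- The Sobolev conjugate exponent of `p` in dimension two:
`p* = 2p / (2 - p)` if `p < 2`, and `p* = +∞` if `p ≥ 2`. -/
def sobolevConjugate (p : ℝ) : ℝ≥0∞ :=
  if p < 2 then ENNReal.ofReal (2 * p / (2 - p)) else ⊤

/-- `g` is a weak gradient of `u` on the open set `A`: both are locally integrable on `A` and
`∫_A u ∂ᵢφ = - ∫_A gᵢ φ` for every `φ ∈ C_c^∞(A)` and `i = 1, 2`. -/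
structure IsWeakGradient (A : Opens Plane) (u : Plane → ℝ) (g : Plane → Plane) : Prop where
  locallyIntegrableOn_fun : LocallyIntegrableOn u (A : Set Plane)
  locallyIntegrableOn_grad : LocallyIntegrableOn g (A : Set Plane)
  integral_eq : ∀ (φ : 𝓓(A, ℝ)) (i : Fin 2),
    ∫ x in (A : Set Plane), u x * (gradient (φ : Plane → ℝ) x) i =
      - ∫ x in (A : Set Plane), (g x) i * φ x

/-- `u` belongs to `W^{1,p}(A)`, with weak gradient `g`. Only the values of `u` and `g` on `A`,
up to null sets, are relevant. -/
structure MemW1p (A : Opens Plane) (p : ℝ) (u : Plane → ℝ) (g : Plane → Plane) : Prop where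
  memLp_fun : MemLp u (ENNReal.ofReal p) (volume.restrict (A : Set Plane))
  memLp_grad : MemLp g (ENNReal.ofReal p) (volume.restrict (A : Set Plane))
  isWeakGradient : IsWeakGradient A u g

/-- `u` belongs to `W_0^{1,p}(A)`, the closure of `C_c^∞(A)` in `W^{1,p}(A)`, and `g` is its
weak gradient. -/
structure MemW01p (A : Opens Plane) (p : ℝ) (u : Plane → ℝ) (g : Plane → Plane) : Prop where
  memW1p : MemW1p A p u g
  exists_approx : ∃ φ : ℕ → 𝓓(A, ℝ),
    Tendsto (fun n => eLpNorm (fun x => φ n x - u x) (ENNReal.ofReal p)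
      (volume.restrict (A : Set Plane))) atTop (𝓝 0) ∧
    Tendsto (fun n => eLpNorm (fun x => gradient (φ n : Plane → ℝ) x - g x) (ENNReal.ofReal p)
      (volume.restrict (A : Set Plane))) atTop (𝓝 0)

/-- The Poincaré–Sobolev constant `C_{p,q}(A)`: the supremum in `[0, +∞]` of
`(∫_A |u|^q)^{p/q} / ∫_A |∇u|^p` over all nonzero `u ∈ W_0^{1,p}(A)`
(so it is `0` if `A` is empty). -/
def poincareSobolev (p q : ℝ) (A : Opens Plane) : ℝ≥0∞ :=
  ⨆ (u : Plane → ℝ) (g : Plane → Plane) (_ : MemW01p A p u g)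
    (_ : ¬ u =ᵐ[volume.restrict (A : Set Plane)] 0),
    (∫⁻ x in (A : Set Plane), ‖u x‖ₑ ^ q) ^ (p / q) / ∫⁻ x in (A : Set Plane), ‖g x‖ₑ ^ p

end

/-!
The gradient of a function in `W_0^{1,p}(A)` satisfies the integration by parts formula against
every `C¹` function with compact support in the plane, because test functions on `A` do and the
formula passes to the limit. Hence extension by zero maps `W_0^{1,p}(A)` into `W_0^{1,p}(B)` for
`A ≤ B`, and `C_{p,q}` is monotone. Conversely, a test function on a disjoint union of open sets
restricts to a test function on each of them, so `u ∈ W_0^{1,p}(A ∪ B)` splits as a sum of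
functions of `W_0^{1,p}(A)` and `W_0^{1,p}(B)`. Since `p / q ≤ 1`, the map `t ↦ t ^ (p / q)` is
subadditive, and the Poincaré–Sobolev inequalities on `A` and `B` add up to one on `A ∪ B`.
-/

section IntegralPairing

variable {α ι 𝕜 : Type*} [RCLike 𝕜] [MeasurableSpace α] {μ : Measure α} {l : Filter ι}
  {p q : ℝ≥0∞}

lemma tendsto_integral_mul_of_tendsto_eLpNorm_sub [ENNReal.HolderConjugate p q]
    {F : ι → α → 𝕜} {f h : α → 𝕜} (hF : ∀ n, MemLp (F n) p μ) (hf : MemLp f p μ)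
    (hh : MemLp h q μ) (hlim : Tendsto (fun n => eLpNorm (F n - f) p μ) l (𝓝 0)) :
    Tendsto (fun n => ∫ x, F n x * h x ∂μ) l (𝓝 (∫ x, f x * h x ∂μ)) := by
  have hbound (n : ι) :
      eLpNorm (F n * h - f * h) 1 μ ≤ eLpNorm (F n - f) p μ * eLpNorm h q μ := by
    rw [← sub_mul, ← smul_eq_mul]
    exact eLpNorm_smul_le_mul_eLpNorm hh.1 ((hF n).sub hf).1
  have hlim' : Tendsto (fun n => eLpNorm (F n - f) p μ * eLpNorm h q μ) l (𝓝 0) := by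
    simpa only [zero_mul] using ENNReal.Tendsto.mul_const hlim (.inr hh.eLpNorm_ne_top)
  exact tendsto_integral_of_L1' _ (hf.1.mul hh.1)
    (.of_forall fun n => memLp_one_iff_integrable.1 (hh.mul (hF n)))
    (tendsto_of_tendsto_of_tendsto_of_le_of_le tendsto_const_nhds hlim' (fun _ => zero_le) hbound)

end IntegralPairing

section ExtensionByZero

variable {α E : Type*} [MeasurableSpace α] [NormedAddCommGroup E] {μ : Measure α} {s t : Set α}

lemma memLp_indicator_restrict_iff (hs : MeasurableSet s) (hst : s ⊆ t) {f : α → E} {r : ℝ≥0∞} :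
    MemLp (s.indicator f) r (μ.restrict t) ↔ MemLp f r (μ.restrict s) := by
  rw [memLp_indicator_iff_restrict hs, Measure.restrict_restrict_of_subset hst]

lemma eLpNorm_sub_indicator_restrict (hs : MeasurableSet s) (hst : s ⊆ t) {f g : α → E}
    {r : ℝ≥0∞} (hf : ∀ x ∉ s, f x = 0) :
    eLpNorm (fun x => f x - s.indicator g x) r (μ.restrict t) =
      eLpNorm (fun x => f x - g x) r (μ.restrict s) := by
  have hsub : (fun x => f x - s.indicator g x) = s.indicator fun x => f x - g x := by
    ext x
    by_cases hx : x ∈ s <;> simp [hx, hf]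
  rw [hsub, eLpNorm_indicator_eq_eLpNorm_restrict hs, Measure.restrict_restrict_of_subset hst]

lemma setIntegral_indicator_of_subset [NormedSpace ℝ E] (hs : MeasurableSet s) (hst : s ⊆ t)
    (f : α → E) : ∫ x in t, s.indicator f x ∂μ = ∫ x in s, f x ∂μ := by
  rw [setIntegral_indicator hs, Set.inter_eq_right.2 hst]

lemma setLIntegral_enorm_indicator_rpow (hs : MeasurableSet s) (hst : s ⊆ t) (f : α → E) {r : ℝ}
    (hr : 0 < r) : ∫⁻ x in t, ‖s.indicator f x‖ₑ ^ r ∂μ = ∫⁻ x in s, ‖f x‖ₑ ^ r ∂μ := by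
  have hpow (x : α) : ‖s.indicator f x‖ₑ ^ r = s.indicator (fun x => ‖f x‖ₑ ^ r) x := by
    by_cases hx : x ∈ s <;> simp [hx, hr]
  simp_rw [hpow]
  rw [setLIntegral_indicator hs, Set.inter_eq_left.2 hst]

lemma ae_eq_zero_of_indicator_ae_eq_zero (hs : MeasurableSet s) (hst : s ⊆ t) {f : α → E}
    (hf : s.indicator f =ᵐ[μ.restrict t] 0) : f =ᵐ[μ.restrict s] 0 := by
  filter_upwards [ae_restrict_of_ae_restrict_of_subset hst hf, ae_restrict_mem hs] with x hx hxs
  rwa [Set.indicator_of_mem hxs] at hx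

end ExtensionByZero

section Gradient

variable {ι : Type*} [Fintype ι]

lemma gradient_apply (f : EuclideanSpace ℝ ι → ℝ) (x : EuclideanSpace ℝ ι) (i : ι) :
    gradient f x i = fderiv ℝ f x (EuclideanSpace.basisFun ι ℝ i) := by
  rw [← inner_gradient_left, EuclideanSpace.inner_basisFun_real]

lemma continuous_gradient_apply {f : EuclideanSpace ℝ ι → ℝ} (hf : ContDiff ℝ 1 f) (i : ι) :
    Continuous fun x => gradient f x i := by
  simp_rw [gradient_apply]
  exact (hf.continuous_fderiv one_ne_zero).clm_apply continuous_const

lemma hasCompactSupport_gradient_apply {f : EuclideanSpace ℝ ι → ℝ} (hf : HasCompactSupport f)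
    (i : ι) : HasCompactSupport fun x => gradient f x i := by
  simp_rw [gradient_apply]
  exact hf.fderiv_apply (𝕜 := ℝ) _

lemma integral_mul_gradient_apply {f g : EuclideanSpace ℝ ι → ℝ} (hf : ContDiff ℝ 1 f)
    (hg : ContDiff ℝ 1 g) (hg' : HasCompactSupport g) (i : ι) :
    ∫ x, f x * gradient g x i = -∫ x, gradient f x i * g x := by
  have h₁ : Integrable fun x => gradient f x i * g x :=
    ((continuous_gradient_apply hf i).mul hg.continuous).integrable_of_hasCompactSupport
      hg'.mul_left
  have h₂ : Integrable fun x => f x * gradient g x i :=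
    (hf.continuous.mul (continuous_gradient_apply hg i)).integrable_of_hasCompactSupport
      (hasCompactSupport_gradient_apply hg' i).mul_left
  have h₃ : Integrable fun x => f x * g x :=
    (hf.continuous.mul hg.continuous).integrable_of_hasCompactSupport hg'.mul_left
  simp_rw [gradient_apply] at h₁ h₂ ⊢
  exact integral_mul_fderiv_eq_neg_fderiv_mul_of_integrable h₁ h₂ h₃
    (fun x _ => hf.differentiable one_ne_zero x) fun x _ => hg.differentiable one_ne_zero x

end Gradient

section TestFunctions

variable {E F : Type*} [NormedAddCommGroup E] [NormedSpace ℝ E] [NormedAddCommGroup F]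
  [NormedSpace ℝ F] {n : ℕ∞} {A B : Opens E}

lemma testFunction_apply_eq_zero (φ : 𝓓^{n}(A, F)) {x : E} (hx : x ∉ A) : φ x = 0 :=
  image_eq_zero_of_notMem_tsupport fun h => hx (φ.tsupport_subset h)

lemma coe_testFunction_mono (h : A ≤ B) (φ : 𝓓^{n}(A, F)) :
    ((TestFunction.monoCLM ℝ φ : 𝓓^{n}(B, F)) : E → F) = φ := by
  rw [TestFunction.monoCLM_apply, if_pos ⟨le_rfl, h⟩]

lemma tsupport_indicator_testFunction_subset (h : (B : Set E) ∩ closure A ⊆ A)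
    (φ : 𝓓^{n}(B, F)) : tsupport ((A : Set E).indicator φ) ⊆ A := by
  intro x hx
  refine h ⟨φ.tsupport_subset (closure_mono ?_ hx), closure_mono Set.support_indicator_subset hx⟩
  rw [Set.support_indicator]
  exact Set.inter_subset_right

/-- The restriction of a test function on `B` to an open set `A` which is closed relative to `B`.
It is encoded as the function on the whole space that vanishes outside `A`. -/
noncomputable def restrictTestFunction (h : (B : Set E) ∩ closure A ⊆ A) (φ : 𝓓^{n}(B, F)) :
    𝓓^{n}(A, F) where
  toFun := (A : Set E).indicator φ
  contDiff' := by
    refine (contMDiff_of_tsupport fun x hx => ContDiffAt.contMDiffAt ?_).contDiff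
    refine φ.contDiff.contDiffAt.congr_of_eventuallyEq ?_
    filter_upwards [A.isOpen.mem_nhds (tsupport_indicator_testFunction_subset h φ hx)]
      with y hy using Set.indicator_of_mem hy _
  hasCompactSupport' := φ.hasCompactSupport.mono
    (by rw [Set.support_indicator]; exact Set.inter_subset_right)
  tsupport_subset' := tsupport_indicator_testFunction_subset h φ

lemma eqOn_restrictTestFunction (h : (B : Set E) ∩ closure A ⊆ A) (φ : 𝓓^{n}(B, F)) :
    Set.EqOn (restrictTestFunction h φ) φ A :=
  Set.eqOn_indicator

end TestFunctions

section TestFunctionGradient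

variable {E : Type*} [NormedAddCommGroup E] [InnerProductSpace ℝ E] [CompleteSpace E] {n : ℕ∞}
  {A B : Opens E}

lemma gradient_testFunction_eq_zero (φ : 𝓓^{n}(A, ℝ)) {x : E} (hx : x ∉ A) :
    gradient φ x = 0 := by
  have hφ : (φ : E → ℝ) =ᶠ[𝓝 x] fun _ => 0 :=
    notMem_tsupport_iff_eventuallyEq.1 fun h => hx (φ.tsupport_subset h)
  rw [hφ.gradient_eq, gradient_fun_const]

lemma eqOn_gradient_restrictTestFunction (h : (B : Set E) ∩ closure A ⊆ A) (φ : 𝓓^{n}(B, ℝ)) :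
    Set.EqOn (gradient (restrictTestFunction h φ)) (gradient φ) A := fun _ hx =>
  ((eqOn_restrictTestFunction h φ).eventuallyEq_of_mem (A.isOpen.mem_nhds hx)).gradient_eq

lemma setIntegral_testFunction_mul_gradient_apply {ι : Type*} [Fintype ι]
    {A : Opens (EuclideanSpace ℝ ι)} (φ : 𝓓(A, ℝ)) {ψ : EuclideanSpace ℝ ι → ℝ}
    (hψ : ContDiff ℝ 1 ψ) (hψ' : HasCompactSupport ψ) (i : ι) :
    ∫ x in (A : Set (EuclideanSpace ℝ ι)), φ x * gradient ψ x i =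
      -∫ x in (A : Set (EuclideanSpace ℝ ι)), gradient φ x i * ψ x := by
  rw [setIntegral_eq_integral_of_forall_compl_eq_zero fun x hx => by
      simp [testFunction_apply_eq_zero φ hx],
    setIntegral_eq_integral_of_forall_compl_eq_zero fun x hx => by
      simp [gradient_testFunction_eq_zero φ hx]]
  exact integral_mul_gradient_apply (φ.contDiff.of_le (mod_cast le_top)) hψ hψ' i

end TestFunctionGradient

section SobolevSpaces

variable {A B : Opens Plane} {p : ℝ} {u : Plane → ℝ} {g : Plane → Plane}

lemma IsWeakGradient.mono (h : A ≤ B) (hu : IsWeakGradient B u g) : IsWeakGradient A u g where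
  locallyIntegrableOn_fun := hu.locallyIntegrableOn_fun.mono_set h
  locallyIntegrableOn_grad := hu.locallyIntegrableOn_grad.mono_set h
  integral_eq φ i := by
    have hB := hu.integral_eq (TestFunction.monoCLM ℝ φ) i
    rw [coe_testFunction_mono h,
      setIntegral_eq_of_subset_of_forall_sdiff_eq_zero B.isOpen.measurableSet h fun x hx => by
        simp [gradient_testFunction_eq_zero φ hx.2],
      setIntegral_eq_of_subset_of_forall_sdiff_eq_zero B.isOpen.measurableSet h fun x hx => by
        simp [testFunction_apply_eq_zero φ hx.2]] at hB
    exact hB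

lemma MemW1p.mono (h : A ≤ B) (hu : MemW1p B p u g) : MemW1p A p u g where
  memLp_fun := hu.memLp_fun.mono_measure (Measure.restrict_mono h le_rfl)
  memLp_grad := hu.memLp_grad.mono_measure (Measure.restrict_mono h le_rfl)
  isWeakGradient := hu.isWeakGradient.mono h

lemma MemW01p.restrict (hAB : A ≤ B) (hcl : (B : Set Plane) ∩ closure A ⊆ A)
    (hu : MemW01p B p u g) : MemW01p A p u g where
  memW1p := hu.memW1p.mono hAB
  exists_approx := by
    obtain ⟨φ, hφ, hφ'⟩ := hu.exists_approx
    have hle : volume.restrict (A : Set Plane) ≤ volume.restrict (B : Set Plane) :=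
      Measure.restrict_mono hAB le_rfl
    refine ⟨fun n => restrictTestFunction hcl (φ n),
      tendsto_of_tendsto_of_tendsto_of_le_of_le tendsto_const_nhds hφ (fun _ => zero_le)
        fun n => ?_,
      tendsto_of_tendsto_of_tendsto_of_le_of_le tendsto_const_nhds hφ' (fun _ => zero_le)
        fun n => ?_⟩
    · refine (eLpNorm_congr_ae ?_).trans_le (eLpNorm_mono_measure _ hle)
      exact ae_restrict_of_forall_mem A.isOpen.measurableSet fun x hx =>
        congrArg (· - u x) (eqOn_restrictTestFunction hcl (φ n) hx)
    · refine (eLpNorm_congr_ae ?_).trans_le (eLpNorm_mono_measure _ hle)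
      exact ae_restrict_of_forall_mem A.isOpen.measurableSet fun x hx =>
        congrArg (· - g x) (eqOn_gradient_restrictTestFunction hcl (φ n) hx)

/-- `ψ` need not vanish near the boundary of `A`: here membership in `W_0^{1,p}(A)`, rather than
in `W^{1,p}(A)`, is essential. -/
lemma MemW01p.integral_mul_gradient_apply (hp : 1 ≤ p) (hu : MemW01p A p u g) {ψ : Plane → ℝ}
    (hψ : ContDiff ℝ 1 ψ) (hψ' : HasCompactSupport ψ) (i : Fin 2) :
    ∫ x in (A : Set Plane), u x * gradient ψ x i = -∫ x in (A : Set Plane), g x i * ψ x := by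
  obtain ⟨φ, hφ, hφ'⟩ := hu.exists_approx
  have hconj := ENNReal.HolderConjugate.conjExponent (ENNReal.one_le_ofReal.2 hp)
  have hφC (n : ℕ) : ContDiff ℝ 1 (φ n) := (φ n).contDiff.of_le (mod_cast le_top)
  have hfun : Tendsto (fun n => ∫ x in (A : Set Plane), φ n x * gradient ψ x i) atTop
      (𝓝 (∫ x in (A : Set Plane), u x * gradient ψ x i)) := by
    refine tendsto_integral_mul_of_tendsto_eLpNorm_sub
      (q := (ENNReal.ofReal p).conjExponent) (fun n => ?_) hu.memW1p.memLp_fun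
      ((continuous_gradient_apply hψ i).memLp_of_hasCompactSupport
        (hasCompactSupport_gradient_apply hψ' i)) hφ
    exact (φ n).continuous.memLp_of_hasCompactSupport (φ n).hasCompactSupport
  have hgrad : Tendsto (fun n => ∫ x in (A : Set Plane), gradient (φ n) x i * ψ x) atTop
      (𝓝 (∫ x in (A : Set Plane), g x i * ψ x)) := by
    refine tendsto_integral_mul_of_tendsto_eLpNorm_sub
      (q := (ENNReal.ofReal p).conjExponent) (fun n => ?_)
      ((EuclideanSpace.proj i : Plane →L[ℝ] ℝ).comp_memLp' hu.memW1p.memLp_grad)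
      (hψ.continuous.memLp_of_hasCompactSupport hψ') ?_
    · exact (continuous_gradient_apply (hφC n) i).memLp_of_hasCompactSupport
        (hasCompactSupport_gradient_apply (φ n).hasCompactSupport i)
    · exact tendsto_of_tendsto_of_tendsto_of_le_of_le tendsto_const_nhds hφ' (fun _ => zero_le)
        fun n => eLpNorm_mono fun x => PiLp.norm_apply_le (gradient (φ n) x - g x) i
  refine tendsto_nhds_unique hfun (hgrad.neg.congr fun n => ?_)
  exact (setIntegral_testFunction_mul_gradient_apply (φ n) hψ hψ' i).symm

lemma MemW01p.isWeakGradient_indicator (hp : 1 ≤ p) (h : A ≤ B) (hu : MemW01p A p u g) :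
    IsWeakGradient B ((A : Set Plane).indicator u) ((A : Set Plane).indicator g) where
  locallyIntegrableOn_fun := locallyIntegrableOn_of_locallyIntegrable_restrict <|
    ((memLp_indicator_restrict_iff A.isOpen.measurableSet h).2
      hu.memW1p.memLp_fun).locallyIntegrable (ENNReal.one_le_ofReal.2 hp)
  locallyIntegrableOn_grad := locallyIntegrableOn_of_locallyIntegrable_restrict <|
    ((memLp_indicator_restrict_iff A.isOpen.measurableSet h).2
      hu.memW1p.memLp_grad).locallyIntegrable (ENNReal.one_le_ofReal.2 hp)
  integral_eq ψ i := by
    have hfun (x : Plane) : (A : Set Plane).indicator u x * gradient ψ x i =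
        (A : Set Plane).indicator (fun x => u x * gradient ψ x i) x := by
      by_cases hx : x ∈ (A : Set Plane) <;> simp [hx]
    have hgrad (x : Plane) : (A : Set Plane).indicator g x i * ψ x =
        (A : Set Plane).indicator (fun x => g x i * ψ x) x := by
      by_cases hx : x ∈ (A : Set Plane) <;> simp [hx]
    simp_rw [hfun, hgrad, setIntegral_indicator_of_subset A.isOpen.measurableSet h]
    exact hu.integral_mul_gradient_apply hp (ψ.contDiff.of_le (mod_cast le_top))
      ψ.hasCompactSupport i

lemma MemW01p.indicator (hp : 1 ≤ p) (h : A ≤ B) (hu : MemW01p A p u g) :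
    MemW01p B p ((A : Set Plane).indicator u) ((A : Set Plane).indicator g) where
  memW1p :=
    { memLp_fun :=
        (memLp_indicator_restrict_iff A.isOpen.measurableSet h).2 hu.memW1p.memLp_fun
      memLp_grad :=
        (memLp_indicator_restrict_iff A.isOpen.measurableSet h).2 hu.memW1p.memLp_grad
      isWeakGradient := hu.isWeakGradient_indicator hp h }
  exists_approx := by
    obtain ⟨φ, hφ, hφ'⟩ := hu.exists_approx
    refine ⟨fun n => TestFunction.monoCLM ℝ (φ n), ?_, ?_⟩
    · simpa only [coe_testFunction_mono h, eLpNorm_sub_indicator_restrict A.isOpen.measurableSet h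
        fun _ hx => testFunction_apply_eq_zero (φ _) hx] using hφ
    · simpa only [coe_testFunction_mono h, eLpNorm_sub_indicator_restrict A.isOpen.measurableSet h
        fun _ hx => gradient_testFunction_eq_zero (φ _) hx] using hφ'

end SobolevSpaces

section PoincareSobolev

variable {A B : Opens Plane} {p q : ℝ} {u : Plane → ℝ} {g : Plane → Plane}

lemma MemW01p.div_le_poincareSobolev (hu : MemW01p A p u g)
    (hne : ¬u =ᵐ[volume.restrict (A : Set Plane)] 0) :
    (∫⁻ x in (A : Set Plane), ‖u x‖ₑ ^ q) ^ (p / q) / ∫⁻ x in (A : Set Plane), ‖g x‖ₑ ^ p ≤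
      poincareSobolev p q A :=
  le_iSup₂_of_le u g (le_iSup₂_of_le hu hne le_rfl)

lemma poincareSobolev_mono (hp : 1 ≤ p) (hq : 0 < q) (h : A ≤ B) :
    poincareSobolev p q A ≤ poincareSobolev p q B := by
  refine iSup₂_le fun u g => iSup₂_le fun hu hne => ?_
  rw [← setLIntegral_enorm_indicator_rpow A.isOpen.measurableSet h u hq,
    ← setLIntegral_enorm_indicator_rpow A.isOpen.measurableSet h g (zero_lt_one.trans_le hp)]
  exact (hu.indicator hp h).div_le_poincareSobolev
    (mt (ae_eq_zero_of_indicator_ae_eq_zero A.isOpen.measurableSet h) hne)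

lemma MemW1p.lintegral_grad_ne_top (hp : 0 < p) (hu : MemW1p A p u g) :
    ∫⁻ x in (A : Set Plane), ‖g x‖ₑ ^ p ≠ ⊤ := by
  have hlt := lintegral_rpow_enorm_lt_top_of_eLpNorm_lt_top (ENNReal.ofReal_pos.2 hp).ne'
    ENNReal.ofReal_ne_top hu.memLp_grad.2
  rw [ENNReal.toReal_ofReal hp.le] at hlt
  exact hlt.ne

lemma MemW01p.lintegral_rpow_le_poincareSobolev_mul (hp : 0 < p) (hq : 0 < q)
    (hfin : poincareSobolev p q A ≠ ⊤) (hu : MemW01p A p u g) :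
    (∫⁻ x in (A : Set Plane), ‖u x‖ₑ ^ q) ^ (p / q) ≤
      poincareSobolev p q A * ∫⁻ x in (A : Set Plane), ‖g x‖ₑ ^ p := by
  by_cases hne : u =ᵐ[volume.restrict (A : Set Plane)] 0
  · have hzero : ∫⁻ x in (A : Set Plane), ‖u x‖ₑ ^ q = 0 := by
      refine lintegral_eq_zero_of_ae_eq_zero ?_
      filter_upwards [hne] with x hx
      simp [hx, hq]
    rw [hzero, ENNReal.zero_rpow_of_pos (div_pos hp hq)]
    exact zero_le
  · exact (ENNReal.div_le_iff_le_mul (.inr hfin)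
      (.inl (hu.memW1p.lintegral_grad_ne_top hp))).1 (hu.div_le_poincareSobolev hne)

lemma union_inter_closure_subset {X : Type*} [TopologicalSpace X] {s t : Set X} (ht : IsOpen t)
    (hst : Disjoint s t) : (s ∪ t) ∩ closure s ⊆ s := by
  rintro x ⟨hx | hx, hxs⟩
  · exact hx
  · exact absurd hx ((hst.closure_left ht).notMem_of_mem_left hxs)

lemma poincareSobolev_sup_le (hp : 0 < p) (hpq : p ≤ q) (hAB : Disjoint (A : Set Plane) B) :
    poincareSobolev p q (A ⊔ B) ≤ max (poincareSobolev p q A) (poincareSobolev p q B) := by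
  set M := max (poincareSobolev p q A) (poincareSobolev p q B)
  rcases eq_or_ne M ⊤ with hM | hM
  · exact hM ▸ le_top
  have hq : 0 < q := hp.trans_le hpq
  have hA : poincareSobolev p q A ≤ M := le_max_left _ _
  have hB : poincareSobolev p q B ≤ M := le_max_right _ _
  refine iSup₂_le fun u g => iSup₂_le fun hu _ => ENNReal.div_le_of_le_mul ?_
  have huA : MemW01p A p u g :=
    hu.restrict le_sup_left (union_inter_closure_subset B.isOpen hAB)
  have huB : MemW01p B p u g :=
    hu.restrict le_sup_right
      (by simpa only [Opens.coe_sup, Set.union_comm] using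
        union_inter_closure_subset A.isOpen hAB.symm)
  rw [Opens.coe_sup, lintegral_union B.isOpen.measurableSet hAB,
    lintegral_union B.isOpen.measurableSet hAB]
  set a := ∫⁻ x in (A : Set Plane), ‖u x‖ₑ ^ q
  set b := ∫⁻ x in (B : Set Plane), ‖u x‖ₑ ^ q
  set a' := ∫⁻ x in (A : Set Plane), ‖g x‖ₑ ^ p
  set b' := ∫⁻ x in (B : Set Plane), ‖g x‖ₑ ^ p
  calc (a + b) ^ (p / q) ≤ a ^ (p / q) + b ^ (p / q) :=
        ENNReal.rpow_add_le_add_rpow _ _ (div_pos hp hq).le ((div_le_one hq).2 hpq)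
    _ ≤ poincareSobolev p q A * a' + poincareSobolev p q B * b' :=
        add_le_add (huA.lintegral_rpow_le_poincareSobolev_mul hp hq (ne_top_of_le_ne_top hM hA))
          (huB.lintegral_rpow_le_poincareSobolev_mul hp hq (ne_top_of_le_ne_top hM hB))
    _ ≤ M * a' + M * b' := by gcongr
    _ = M * (a' + b') := (mul_add _ _ _).symm

end PoincareSobolev

theorem lemma5p3_general {p q : ℝ} (hp : 1 ≤ p) (hpq : p ≤ q) {A₁ A₂ : Opens Plane}
    (hdisj : Disjoint (A₁ : Set Plane) (A₂ : Set Plane)) :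
    poincareSobolev p q (A₁ ⊔ A₂) = max (poincareSobolev p q A₁) (poincareSobolev p q A₂) := by
  have hp₀ : 0 < p := zero_lt_one.trans_le hp
  have hq₀ : 0 < q := hp₀.trans_le hpq
  exact le_antisymm (poincareSobolev_sup_le hp₀ hpq hdisj)
    (max_le (poincareSobolev_mono hp hq₀ le_sup_left) (poincareSobolev_mono hp hq₀ le_sup_right))

theorem lemma5p3 (Ω : Opens Plane) (hΩ_bounded : Bornology.IsBounded (Ω : Set Plane))
    (hΩ_connected : IsConnected (Ω : Set Plane)) (p q : ℝ) (hp : 1 < p) (hpq : p ≤ q)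
    (hq : ENNReal.ofReal q < sobolevConjugate p) (A₁ A₂ : Opens Plane) (hA₁ : A₁ ≤ Ω)
    (hA₂ : A₂ ≤ Ω) (hdisj : Disjoint (A₁ : Set Plane) (A₂ : Set Plane)) :
    poincareSobolev p q (A₁ ⊔ A₂) = max (poincareSobolev p q A₁) (poincareSobolev p q A₂) := by
  exact lemma5p3_general hp.le hpq hdisj
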